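/- Let $A$ and $B$ be positive definite operators on a finite-dimensional complex Hilbert space. For self-adjoint operators $X,Y$ write $\{X>Y\}$ for the orthogonal projection onto the positive part of $X-Y$, i.e. onto the span of the eigenvectors of $X-Y$ with strictly positive eigenvalue, and let $D(A\|B):=\operatorname{Tr}[A(\log A-\log B)]$ be the Umegaki relative entropy. Then $$\log A-\log B=\int_1^\infty\{A>\alpha B\}\,\frac{1}{\alpha}\,\mathrm d\alpha-\int_1^\infty\{B>\alpha A\}\,\frac{1}{\alpha}\,\mathrm d\alpha$$ and $$D(A\|B)=\int_1^\infty\frac1\gamma\operatorname{Tr}\big[A\big(\{A>\gamma B\}-\{B>\gamma A\}\big)\big]\,\mathrm d\gamma,$$ where all the integrals converge absolutely. -/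

import Mathlib

open MeasureTheory Set

noncomputable section

namespace LayerCake

variable {E : Type*} [NormedAddCommGroup E] [InnerProductSpace ℂ E] [FiniteDimensional ℂ E]

/-- The positive part of the spectrum of `X`, as a subspace: the span of all eigenvectors of `X`
with a (strictly) positive real eigenvalue. -/
def posSubspace (X : E →L[ℂ] E) : Submodule ℂ E :=
  ⨆ μ : {μ : ℝ // 0 < μ}, Module.End.eigenspace (X : E →ₗ[ℂ] E) ((μ : ℝ) : ℂ)

/-- The projection `{X > Y}`: the orthogonal projection onto the positive part of the
operator `X - Y` (used for self-adjoint `X` and `Y`). -/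
def projGT (X Y : E →L[ℂ] E) : E →L[ℂ] E :=
  (posSubspace (X - Y)).starProjection

/-- The trace of an operator on the finite-dimensional space `E`. -/
def opTrace (X : E →L[ℂ] E) : ℂ :=
  LinearMap.trace ℂ E (X : E →ₗ[ℂ] E)

/-- The Umegaki relative entropy `D(A‖B) = Tr[A (log A - log B)]` of positive definite operators;
`CFC.log` is the operator logarithm (the spectral calculus applied to `Real.log`). -/
def relEntropy [CompleteSpace E] (A B : E →L[ℂ] E) : ℂ :=
  opTrace (A * (CFC.log A - CFC.log B))

end LayerCake

end

/-!
Write `R A B` for the difference of integrals that is to equal `log A - log B` (`layerLog`). The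
proof identifies `R A B` as the gradient in `A` of the functional

`F A B = ∫₁^∞ Tr (A - α B)₊ dα / α + ∫₁^∞ Tr (B - α A)₊ dα / α²` (`layerEntropy`),

and shows that `F A B` is the relative entropy `D(A‖B) - Tr A + Tr B` (`umegaki`), whose gradient
in `A` is `log A - log B`.

* *Convexity.* Since `Tr Y P ≤ Tr Y₊` for every projection `P`, with equality for `P = {Y > 0}`
  (`reTr_mul_posProj_le`), the functional `F` is convex and positively homogeneous in `(A, B)`, and
  the projections supply an explicit subgradient `(R, Q)`, where `Q` is `layerGradRight`
  (`reTr_mul_layer_le_layerEntropy`).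
* *Traces of the subgradient.* By Sylvester's law of inertia the rank of `{A > α B}` is the number
  of eigenvalues of `B^{-1/2} A B^{-1/2}` above `α` (`exists_pencil_eigenvalues`). Integrating
  these counts gives `Tr R = log det A - log det B` and `Tr Q = Tr (1 - B⁻¹ A)`
  (`reTr_layerLog_add_layerGradRight`).
* *Identification of `F`.* Along the path `(A + s, B + s)` only the trace of the subgradient enters.
  It is continuous in `s`, so it is the derivative of `F`; it is also the derivative of the relative
  entropy. Both functionals tend to `0` as `s → ∞`, hence they agree (`layerEntropy_eq_umegaki`).
* *The gradient.* Now `R A B` is a subgradient of `umegaki · B` at `A`. As `F ≥ 0`, Klein's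
  inequality is available and bounds the increments of `umegaki · B` from above by those of
  `log - log B` (`reTr_sub_mul_layerLog_le`). Moving `A` in the direction of
  `R A B - (log A - log B)` and using continuity of the logarithm shows that this difference
  vanishes (`layerLog_eq`).

The formula for `D(A‖B)` follows by applying the continuous functional `X ↦ Tr (A X)`. All
integrands vanish for large `α`; their measurability holds because a spectral projection is a
pointwise limit of continuous functions of the operator (`tendsto_cfc_posProj`).
-/

noncomputable section

namespace LayerCake

set_option linter.unusedSectionVars false

open Filter Topology
open scoped InnerProductSpace

variable {E : Type*} [NormedAddCommGroup E] [InnerProductSpace ℂ E] [FiniteDimensional ℂ E]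

/-! ### The real trace and eigenbases -/

/-- The trace as a continuous linear functional on operators. -/
def opTraceL : (E →L[ℂ] E) →L[ℂ] ℂ :=
  LinearMap.toContinuousLinearMap (LinearMap.trace ℂ E ∘ₗ ContinuousLinearMap.coeLM ℂ)

/-- The real part of the trace, as a continuous real-linear functional. -/
def reTr : (E →L[ℂ] E) →L[ℝ] ℝ :=
  Complex.reCLM ∘L opTraceL.restrictScalars ℝ

lemma reTr_apply (X : E →L[ℂ] E) : reTr X = (opTrace X).re := rfl

lemma reTr_mul_comm (X Y : E →L[ℂ] E) : reTr (X * Y) = reTr (Y * X) := by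
  simp only [reTr_apply, opTrace]
  exact congrArg Complex.re
    (LinearMap.trace_mul_comm ℂ (X : E →ₗ[ℂ] E) (Y : E →ₗ[ℂ] E))

lemma reTr_eq_sum {ι : Type*} [Fintype ι] (b : OrthonormalBasis ι ℂ E) (X : E →L[ℂ] E) :
    reTr X = ∑ i, (⟪b i, X (b i)⟫_ℂ).re := by
  rw [reTr_apply, opTrace, LinearMap.trace_eq_sum_inner _ b, Complex.re_sum]
  rfl

lemma re_inner_basis_smul {ι : Type*} [Fintype ι] (b : OrthonormalBasis ι ℂ E) (i : ι) (r : ℝ) :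
    (⟪b i, (r : ℂ) • b i⟫_ℂ).re = r := by
  simp

lemma reTr_eq_sum_of_apply {ι : Type*} [Fintype ι] (b : OrthonormalBasis ι ℂ E) {l : ι → ℝ}
    {X : E →L[ℂ] E} (h : ∀ i, X (b i) = (l i : ℂ) • b i) : reTr X = ∑ i, l i := by
  rw [reTr_eq_sum b]
  refine Finset.sum_congr rfl fun i _ => ?_
  rw [h, re_inner_basis_smul]

lemma reTr_mul_eq_sum_of_apply {ι : Type*} [Fintype ι] (b : OrthonormalBasis ι ℂ E) {l : ι → ℝ}
    {X : E →L[ℂ] E} (h : ∀ i, X (b i) = (l i : ℂ) • b i) (M : E →L[ℂ] E) :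
    reTr (M * X) = ∑ i, l i * (⟪b i, M (b i)⟫_ℂ).re := by
  rw [reTr_eq_sum b]
  refine Finset.sum_congr rfl fun i _ => ?_
  simp [h]

lemma ext_of_basis {ι : Type*} [Fintype ι] (b : OrthonormalBasis ι ℂ E) {X Y : E →L[ℂ] E}
    (h : ∀ i, X (b i) = Y (b i)) : X = Y := by
  ext v
  have : (X : E →ₗ[ℂ] E) = (Y : E →ₗ[ℂ] E) := b.toBasis.ext fun i => by simpa using h i
  exact congrArg (fun f : E →ₗ[ℂ] E => f v) this

lemma det_eq_prod_of_apply {ι : Type*} [Fintype ι] {a : ι → ℝ}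
    {A : E →L[ℂ] E} (u : OrthonormalBasis ι ℂ E) (hu : ∀ i, A (u i) = (a i : ℂ) • u i) :
    LinearMap.det (A : E →ₗ[ℂ] E) = ∏ i, (a i : ℂ) := by
  classical
  have h : LinearMap.toMatrix u.toBasis u.toBasis (A : E →ₗ[ℂ] E) =
      Matrix.diagonal fun i => (a i : ℂ) := by
    ext i j
    rw [LinearMap.toMatrix_apply]
    have : (A : E →ₗ[ℂ] E) (u.toBasis j) = (a j : ℂ) • u.toBasis j := by simpa using hu j
    rw [this, map_smul, Module.Basis.repr_self]
    by_cases hij : i = j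
    · subst hij; simp
    · simp [Matrix.diagonal_apply_ne _ hij, Ne.symm hij]
  rw [← LinearMap.det_toMatrix u.toBasis, h, Matrix.det_diagonal]

/-- The projection onto the positive part of the spectrum of `X`. -/
def posProj (X : E →L[ℂ] E) : E →L[ℂ] E := (posSubspace X).starProjection

lemma projGT_eq (X Y : E →L[ℂ] E) : projGT X Y = posProj (X - Y) := rfl

lemma norm_posProj_le (X : E →L[ℂ] E) : ‖posProj X‖ ≤ 1 := Submodule.starProjection_norm_le _

lemma norm_projGT_le (X Y : E →L[ℂ] E) : ‖projGT X Y‖ ≤ 1 := norm_posProj_le _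

lemma re_inner_posProj_nonneg (X : E →L[ℂ] E) (v : E) : 0 ≤ (⟪v, posProj X v⟫_ℂ).re := by
  have h := Submodule.re_inner_starProjection_nonneg (posSubspace X) v
  rw [Submodule.inner_starProjection_left_eq_right] at h
  exact h

lemma re_inner_posProj_le (X : E →L[ℂ] E) (v : E) : (⟪v, posProj X v⟫_ℂ).re ≤ ‖v‖ ^ 2 := by
  calc (⟪v, posProj X v⟫_ℂ).re ≤ ‖⟪v, posProj X v⟫_ℂ‖ := Complex.re_le_norm _
    _ ≤ ‖v‖ * ‖posProj X v‖ := norm_inner_le_norm _ _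
    _ ≤ ‖v‖ * ‖v‖ := by
      gcongr
      exact Submodule.norm_starProjection_apply_le _ _
    _ = ‖v‖ ^ 2 := (sq _).symm

variable [CompleteSpace E]

lemma exists_eigenbasis {X : E →L[ℂ] E} (hX : IsSelfAdjoint X) :
    ∃ (b : OrthonormalBasis (Fin (Module.finrank ℂ E)) ℂ E) (l : Fin (Module.finrank ℂ E) → ℝ),
      ∀ i, X (b i) = (l i : ℂ) • b i := by
  have h := ContinuousLinearMap.isSelfAdjoint_iff_isSymmetric.mp hX
  exact ⟨h.eigenvectorBasis rfl, h.eigenvalues rfl, fun i => h.apply_eigenvectorBasis rfl i⟩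

lemma inner_apply_of_isSelfAdjoint {X : E →L[ℂ] E} (hX : IsSelfAdjoint X) (v w : E) :
    ⟪X v, w⟫_ℂ = ⟪v, X w⟫_ℂ :=
  ContinuousLinearMap.isSelfAdjoint_iff_isSymmetric.mp hX v w

lemma inner_eq_zero_of_mem_posSubspace {X : E →L[ℂ] E} (hX : IsSelfAdjoint X) {v w : E} {r : ℝ}
    (hv : X v = (r : ℂ) • v) (hr : r ≤ 0) (hw : w ∈ posSubspace X) : ⟪w, v⟫_ℂ = 0 := by
  refine Submodule.iSup_induction _ (motive := fun w => ⟪w, v⟫_ℂ = 0) hw ?_ (by simp) ?_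
  · rintro ⟨μ, hμ⟩ x hx
    rw [Module.End.mem_eigenspace_iff] at hx
    have hx' : X x = (μ : ℂ) • x := hx
    have h := inner_apply_of_isSelfAdjoint hX x v
    rw [hx', hv, inner_smul_left, inner_smul_right, Complex.conj_ofReal] at h
    have h2 : ((μ : ℂ) - r) * ⟪x, v⟫_ℂ = 0 := by linear_combination h
    rcases mul_eq_zero.mp h2 with h3 | h3
    · exfalso
      rw [sub_eq_zero] at h3
      have : μ = r := by exact_mod_cast h3
      linarith
    · exact h3
  · intro x y hx hy
    rw [inner_add_left, hx, hy, add_zero]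

lemma posProj_apply {X : E →L[ℂ] E} (hX : IsSelfAdjoint X) {v : E} {r : ℝ}
    (hv : X v = (r : ℂ) • v) : posProj X v = ((if 0 < r then 1 else 0 : ℝ) : ℂ) • v := by
  split_ifs with hr
  · rw [Complex.ofReal_one, one_smul]
    refine Submodule.starProjection_eq_self_iff.mpr ?_
    refine Submodule.mem_iSup_of_mem (⟨r, hr⟩ : {μ : ℝ // 0 < μ}) ?_
    rw [Module.End.mem_eigenspace_iff]
    exact hv
  · rw [Complex.ofReal_zero, zero_smul]
    refine (Submodule.starProjection_apply_eq_zero_iff _).mpr ?_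
    rw [Submodule.mem_orthogonal]
    exact fun w hw => inner_eq_zero_of_mem_posSubspace hX hv (not_lt.mp hr) hw

lemma finite_real_spectrum (X : E →L[ℂ] E) : (spectrum ℝ X).Finite := by
  have h : (spectrum ℂ X).Finite := by
    have h1 := Module.End.finite_spectrum (X : E →ₗ[ℂ] E)
    refine h1.subset fun z hz => ?_
    rw [spectrum.mem_iff] at hz ⊢
    intro hu
    apply hz
    rw [ContinuousLinearMap.isUnit_iff_bijective]
    have := (Module.End.isUnit_iff _).mp hu
    exact this
  rw [← spectrum.preimage_algebraMap ℂ]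
  exact h.preimage (FaithfulSMul.algebraMap_injective ℝ ℂ).injOn

lemma aeval_apply_of_eigen {X : E →L[ℂ] E} {v : E} {r : ℝ} (hv : X v = (r : ℂ) • v)
    (p : Polynomial ℝ) : Polynomial.aeval X p v = ((p.eval r : ℝ) : ℂ) • v := by
  induction p using Polynomial.induction_on' with
  | add p q hp hq => simp [hp, hq, add_smul]
  | monomial n a =>
    have hpow : (X ^ n) v = ((r : ℂ) ^ n) • v := by
      induction n with
      | zero => simp
      | succ n ih =>
        rw [pow_succ, mul_apply_eq_comp, hv, map_smul, ih, smul_smul, pow_succ,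
          mul_comm]
    rw [Polynomial.aeval_monomial, Polynomial.eval_monomial, mul_apply_eq_comp, hpow,
      Algebra.algebraMap_eq_smul_one]
    simp [mul_smul, smul_comm a]

lemma mem_spectrum_of_eigen {X : E →L[ℂ] E} {v : E} {r : ℝ} (hv : X v = (r : ℂ) • v)
    (hv0 : v ≠ 0) : r ∈ spectrum ℝ X := by
  rw [spectrum.mem_iff]
  intro hu
  have hinj := (ContinuousLinearMap.isUnit_iff_bijective.mp hu).1
  apply hv0
  apply hinj
  rw [map_zero, Algebra.algebraMap_eq_smul_one]
  simp [hv]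

/-- The functional calculus acts on an eigenvector through the value at its eigenvalue. No
continuity is needed, the spectrum being finite. -/
lemma cfc_apply_of_eigen {X : E →L[ℂ] E} (hX : IsSelfAdjoint X) (f : ℝ → ℝ) {v : E} {r : ℝ}
    (hv : X v = (r : ℂ) • v) : cfc f X v = (f r : ℂ) • v := by
  rcases eq_or_ne v 0 with rfl | hv0
  · simp
  have hfin := finite_real_spectrum X
  have hp : ∀ x ∈ spectrum ℝ X, (Lagrange.interpolate hfin.toFinset id f).eval x = f x := by
    intro x hx
    exact Lagrange.eval_interpolate_at_node (v := id) f (injOn_id _) (hfin.mem_toFinset.mpr hx)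
  have h1 : cfc f X = Polynomial.aeval X (Lagrange.interpolate hfin.toFinset id f) := by
    rw [← cfc_polynomial _ X hX]
    exact cfc_congr fun x hx => (hp x hx).symm
  rw [h1, aeval_apply_of_eigen hv, hp r (mem_spectrum_of_eigen hv hv0)]

lemma log_apply_of_eigen {X : E →L[ℂ] E} (hX : IsSelfAdjoint X) {v : E} {r : ℝ}
    (hv : X v = (r : ℂ) • v) : CFC.log X v = (Real.log r : ℂ) • v :=
  cfc_apply_of_eigen hX Real.log hv

lemma posProj_eq_cfc {X : E →L[ℂ] E} (hX : IsSelfAdjoint X) :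
    posProj X = cfc (fun x : ℝ => if 0 < x then 1 else 0) X := by
  obtain ⟨b, l, hb⟩ := exists_eigenbasis hX
  refine ext_of_basis b fun i => ?_
  rw [posProj_apply hX (hb i), cfc_apply_of_eigen hX _ (hb i)]

/-- The spectral projection is a pointwise limit of continuous functions of the operator, because
`min 1 (n x₊)` agrees with the indicator of `(0, ∞)` on a given finite set for large `n`. -/
lemma tendsto_cfc_posProj {X : E →L[ℂ] E} (hX : IsSelfAdjoint X) :
    Tendsto (fun n : ℕ => cfc (fun x : ℝ => min 1 (n * max x 0)) X) atTop (𝓝 (posProj X)) := by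
  have hev : ∀ᶠ n : ℕ in atTop, ∀ x ∈ spectrum ℝ X,
      min 1 (n * max x 0) = if 0 < x then (1 : ℝ) else 0 := by
    rw [Filter.eventually_all_finite (finite_real_spectrum X)]
    intro x _
    split_ifs with hx
    · filter_upwards [eventually_ge_atTop ⌈x⁻¹⌉₊] with n hn
      rw [max_eq_left hx.le, min_eq_left]
      have h1 : x⁻¹ ≤ n := (Nat.le_ceil _).trans (by exact_mod_cast hn)
      calc (1 : ℝ) = x⁻¹ * x := (inv_mul_cancel₀ hx.ne').symm
        _ ≤ n * x := by gcongr
    · filter_upwards with n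
      rw [max_eq_right (not_lt.mp hx)]
      simp
  refine tendsto_const_nhds.congr' ?_
  filter_upwards [hev] with n hn
  rw [posProj_eq_cfc hX]
  exact cfc_congr fun x hx => (hn x hx).symm

lemma stronglyMeasurable_posProj {X : ℝ → E →L[ℂ] E} (hc : Continuous X)
    (hX : ∀ t, IsSelfAdjoint (X t)) : StronglyMeasurable fun t => posProj (X t) := by
  refine stronglyMeasurable_of_tendsto atTop
    (f := fun (n : ℕ) t => cfc (fun x : ℝ => min 1 (n * max x 0)) (X t)) (fun n => ?_) ?_
  · refine Continuous.stronglyMeasurable ?_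
    refine Continuous.cfc_of_mem_nhdsSet (s := univ) _ univ_mem hc hX ?_
    exact (by fun_prop : Continuous fun x : ℝ => min 1 ((n : ℝ) * max x 0)).continuousOn
  · rw [tendsto_pi_nhds]
    exact fun t => tendsto_cfc_posProj (hX t)

/-! ### The variational principle -/

/-- Among all spectral projections `P`, the trace `Tr Y P` is largest for `P = {Y > 0}`. -/
lemma reTr_mul_posProj_le (X : E →L[ℂ] E) {Y : E →L[ℂ] E} (hY : IsSelfAdjoint Y) :
    reTr (Y * posProj X) ≤ reTr (Y * posProj Y) := by
  obtain ⟨b, l, hb⟩ := exists_eigenbasis hY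
  rw [reTr_mul_comm, reTr_mul_comm Y, reTr_mul_eq_sum_of_apply b hb,
    reTr_mul_eq_sum_of_apply b hb]
  refine Finset.sum_le_sum fun i _ => ?_
  have h0 := re_inner_posProj_nonneg X (b i)
  have h1 := re_inner_posProj_le X (b i)
  rw [b.orthonormal.1 i, one_pow] at h1
  rw [posProj_apply hY (hb i), re_inner_basis_smul]
  split_ifs with hl
  · exact mul_le_mul_of_nonneg_left h1 hl.le
  · rw [mul_zero]
    exact mul_nonpos_of_nonpos_of_nonneg (not_lt.mp hl) h0

lemma posSubspace_eq_bot {X : E →L[ℂ] E} (h : ∀ v, (⟪v, X v⟫_ℂ).re ≤ 0) : posSubspace X = ⊥ := by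
  refine iSup_eq_bot.mpr ?_
  rintro ⟨μ, hμ⟩
  rw [eq_bot_iff]
  intro v hv
  rw [Module.End.mem_eigenspace_iff] at hv
  have hv' : X v = (μ : ℂ) • v := hv
  have h1 := h v
  rw [hv', inner_smul_right, inner_self_eq_norm_sq_to_K] at h1
  have h2 : μ * ‖v‖ ^ 2 ≤ 0 := by
    have : ((μ : ℂ) * ((‖v‖ : ℝ) : ℂ) ^ 2).re = μ * ‖v‖ ^ 2 := by
      rw [← Complex.ofReal_pow, ← Complex.ofReal_mul, Complex.ofReal_re]
    rw [← this]
    exact h1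
  have h3 : ‖v‖ ^ 2 = 0 := by
    have := sq_nonneg ‖v‖
    nlinarith
  simpa using h3

lemma posProj_eq_zero_of_nonpos {X : E →L[ℂ] E} (h : X ≤ 0) : posProj X = 0 := by
  have : posSubspace X = ⊥ := by
    refine posSubspace_eq_bot fun v => ?_
    rw [ContinuousLinearMap.le_def] at h
    have h1 := h.re_inner_nonneg_right v
    simpa using h1
  simp only [posProj, this, Submodule.starProjection_bot]

/-! ### Inertia and the eigenvalues of a positive pencil -/

lemma re_inner_eq_sum {ι : Type*} [Fintype ι] (b : OrthonormalBasis ι ℂ E) {l : ι → ℝ}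
    {X : E →L[ℂ] E} (h : ∀ i, X (b i) = (l i : ℂ) • b i) (v : E) :
    (⟪v, X v⟫_ℂ).re = ∑ i, l i * ‖⟪b i, v⟫_ℂ‖ ^ 2 := by
  have hXv : X v = ∑ i, (⟪b i, v⟫_ℂ * l i) • b i := by
    conv_lhs => rw [← b.sum_repr' v]
    rw [map_sum]
    exact Finset.sum_congr rfl fun i _ => by rw [map_smul, h, smul_smul]
  rw [hXv, inner_sum, Complex.re_sum]
  refine Finset.sum_congr rfl fun i _ => ?_
  rw [inner_smul_right, ← inner_conj_symm v (b i)]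
  have : ⟪b i, v⟫_ℂ * l i * (starRingEnd ℂ) ⟪b i, v⟫_ℂ
      = ((l i * ‖⟪b i, v⟫_ℂ‖ ^ 2 : ℝ) : ℂ) := by
    rw [mul_right_comm, Complex.mul_conj, Complex.normSq_eq_norm_sq]
    push_cast
    ring
  rw [this, Complex.ofReal_re]

lemma exists_inner_ne_zero {ι : Type*} [Fintype ι] (b : OrthonormalBasis ι ℂ E) {v : E}
    (hv : v ≠ 0) : ∃ i, ⟪b i, v⟫_ℂ ≠ 0 := by
  by_contra! h
  apply hv
  rw [← b.sum_repr' v]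
  simp [h]

lemma re_inner_pos_of_mem_posSubspace {X : E →L[ℂ] E} (hX : IsSelfAdjoint X) {v : E}
    (hv : v ∈ posSubspace X) (hv0 : v ≠ 0) : 0 < (⟪v, X v⟫_ℂ).re := by
  obtain ⟨b, l, hb⟩ := exists_eigenbasis hX
  rw [re_inner_eq_sum b hb]
  have hz : ∀ i, l i ≤ 0 → ⟪b i, v⟫_ℂ = 0 := fun i hi => by
    rw [← inner_conj_symm, inner_eq_zero_of_mem_posSubspace hX (hb i) hi hv, map_zero]
  obtain ⟨i, hi⟩ := exists_inner_ne_zero b hv0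
  refine Finset.sum_pos' (fun j _ => ?_) ⟨i, Finset.mem_univ _, ?_⟩
  · rcases le_or_gt (l j) 0 with hj | hj
    · simp [hz j hj]
    · positivity
  · have hli : 0 < l i := by
      by_contra! hle
      exact hi (hz i hle)
    have := norm_pos_iff.mpr hi
    positivity

lemma re_inner_nonpos_of_mem_orthogonal {X : E →L[ℂ] E} (hX : IsSelfAdjoint X) {v : E}
    (hv : v ∈ (posSubspace X)ᗮ) : (⟪v, X v⟫_ℂ).re ≤ 0 := by
  obtain ⟨b, l, hb⟩ := exists_eigenbasis hX
  rw [re_inner_eq_sum b hb]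
  refine Finset.sum_nonpos fun i _ => ?_
  rcases le_or_gt (l i) 0 with hi | hi
  · exact mul_nonpos_of_nonpos_of_nonneg hi (sq_nonneg _)
  · have hmem : b i ∈ posSubspace X := by
      refine Submodule.mem_iSup_of_mem (⟨l i, hi⟩ : {μ : ℝ // 0 < μ}) ?_
      rw [Module.End.mem_eigenspace_iff]
      exact hb i
    rw [(Submodule.mem_orthogonal _ _).mp hv _ hmem]
    simp

/-- One half of Sylvester's law of inertia. -/
lemma finrank_posSubspace_conj_le {X M : E →L[ℂ] E} (hX : IsSelfAdjoint X) (hM : IsSelfAdjoint M)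
    (hMu : IsUnit M) :
    Module.finrank ℂ (posSubspace (M * X * M)) ≤ Module.finrank ℂ (posSubspace X) := by
  have hY : IsSelfAdjoint (M * X * M) := by
    have := hX.conjugate M
    rwa [hM.star_eq] at this
  have hinj : Function.Injective (M : E →ₗ[ℂ] E) :=
    (ContinuousLinearMap.isUnit_iff_bijective.mp hMu).1
  -- the form of `X` is positive on one subspace and nonpositive on the other
  have hdisj : Disjoint ((posSubspace (M * X * M)).map (M : E →ₗ[ℂ] E)) (posSubspace X)ᗮ := by
    rw [Submodule.disjoint_def]
    rintro _ ⟨y, hy, rfl⟩ hW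
    by_contra hne
    have hy0 : y ≠ 0 := by
      rintro rfl
      exact hne (map_zero _)
    have h1 := re_inner_pos_of_mem_posSubspace hY hy hy0
    have h2 := re_inner_nonpos_of_mem_orthogonal hX hW
    have h3 : ⟪y, (M * X * M) y⟫_ℂ = ⟪M y, X (M y)⟫_ℂ := by
      rw [inner_apply_of_isSelfAdjoint hM]
      rfl
    rw [h3] at h1
    exact absurd h2 (not_le.mpr h1)
  have h1 := Submodule.finrank_add_finrank_le_of_disjoint hdisj
  have h2 := Submodule.finrank_add_finrank_orthogonal (posSubspace X)
  have h3 := LinearEquiv.finrank_eq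
    (Submodule.equivMapOfInjective (M : E →ₗ[ℂ] E) hinj (posSubspace (M * X * M)))
  omega

/-- Sylvester's law of inertia for the positive index. -/
lemma finrank_posSubspace_conj {X M N : E →L[ℂ] E} (hX : IsSelfAdjoint X) (hM : IsSelfAdjoint M)
    (hN : IsSelfAdjoint N) (hMN : M * N = 1) (hNM : N * M = 1) :
    Module.finrank ℂ (posSubspace (M * X * M)) = Module.finrank ℂ (posSubspace X) := by
  have hMu : IsUnit M := ⟨⟨M, N, hMN, hNM⟩, rfl⟩
  have hNu : IsUnit N := ⟨⟨N, M, hNM, hMN⟩, rfl⟩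
  have hY : IsSelfAdjoint (M * X * M) := by
    have := hX.conjugate M
    rwa [hM.star_eq] at this
  refine le_antisymm (finrank_posSubspace_conj_le hX hM hMu) ?_
  have h := finrank_posSubspace_conj_le hY hN hNu
  have h2 : N * (M * X * M) * N = X := by
    calc N * (M * X * M) * N = (N * M) * X * (M * N) := by simp only [mul_assoc]
      _ = X := by rw [hNM, hMN, one_mul, mul_one]
  rwa [h2] at h

lemma reTr_posProj (X : E →L[ℂ] E) :
    reTr (posProj X) = Module.finrank ℂ (posSubspace X) := by
  have h : LinearMap.IsProj (posSubspace X) (posProj X : E →ₗ[ℂ] E) :=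
    ⟨fun x => Submodule.starProjection_apply_mem _ x,
      fun x hx => Submodule.starProjection_eq_self_iff.mpr hx⟩
  rw [reTr_apply, opTrace, h.trace, Complex.natCast_re]

lemma reTr_posProj_of_apply {ι : Type*} [Fintype ι] (b : OrthonormalBasis ι ℂ E) {l : ι → ℝ}
    {X : E →L[ℂ] E} (hX : IsSelfAdjoint X) (h : ∀ i, X (b i) = (l i : ℂ) • b i) :
    reTr (posProj X) = ∑ i, if 0 < l i then 1 else 0 :=
  reTr_eq_sum_of_apply b fun i => posProj_apply hX (h i)

lemma real_smul_apply (r : ℝ) (X : E →L[ℂ] E) (v : E) : (r • X) v = (r : ℂ) • X v := by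
  simp

lemma isSelfAdjoint_sub_smul {A B : E →L[ℂ] E} (hA : IsSelfAdjoint A) (hB : IsSelfAdjoint B)
    (r : ℝ) : IsSelfAdjoint (A - r • B) :=
  hA.sub ((IsSelfAdjoint.all r).smul hB)

/-- The eigenvalues `c` of the pencil `A - α B`, that is, of `B^{-1/2} A B^{-1/2}`. By the law of
inertia they count the ranks of the projections `{A > α B}` and `{B > α A}`. -/
lemma exists_pencil_eigenvalues {A B : E →L[ℂ] E} (hA : IsStrictlyPositive A)
    (hB : IsStrictlyPositive B) :
    ∃ c : Fin (Module.finrank ℂ E) → ℝ, (∀ j, 0 < c j) ∧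
      (∀ α : ℝ, reTr (projGT A (α • B)) = ∑ j, if α < c j then 1 else 0) ∧
      (∀ α : ℝ, reTr (projGT B (α • A)) = ∑ j, if α * c j < 1 then 1 else 0) ∧
      (∏ j, (c j : ℂ)) * LinearMap.det (B : E →ₗ[ℂ] E) = LinearMap.det (A : E →ₗ[ℂ] E) ∧
      ∀ N : E →L[ℂ] E, N * B = 1 → reTr (A * N) = ∑ j, c j := by
  have hAs : IsSelfAdjoint A := hA.isSelfAdjoint
  have hBs : IsSelfAdjoint B := hB.isSelfAdjoint
  -- `M = B^{-1/2}`, with inverse `B M`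
  set M : E →L[ℂ] E := B ^ (-(1 / 2) : ℝ) with hMdef
  have hM : IsSelfAdjoint M := IsSelfAdjoint.of_nonneg CFC.rpow_nonneg
  have hMBM : M * B * M = 1 := CFC.conjugate_rpow_neg_one_half B hB
  have hcomm : M * B = B * M := by
    calc M * B = (M * B) * (M * (B * M)) := by rw [← mul_assoc M, hMBM, mul_one]
      _ = (M * B * M) * (B * M) := by simp only [mul_assoc]
      _ = B * M := by rw [hMBM, one_mul]
  have hN : IsSelfAdjoint (B * M) := by
    rw [isSelfAdjoint_iff, star_mul, hM.star_eq, hBs.star_eq, hcomm]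
  have hMN : M * (B * M) = 1 := by rw [← mul_assoc, hMBM]
  have hNM : (B * M) * M = 1 := by rw [← hcomm, hMBM]
  have hMu : IsUnit M := ⟨⟨M, B * M, hMN, hNM⟩, rfl⟩
  set C : E →L[ℂ] E := M * A * M with hCdef
  have hC : IsStrictlyPositive C := hA.conjugate_of_isUnit_of_isSelfAdjoint A M hMu hM
  have hCs : IsSelfAdjoint C := hC.isSelfAdjoint
  obtain ⟨b, c, hb⟩ := exists_eigenbasis hCs
  have hpos : ∀ j, 0 < c j := fun j =>
    hC.spectrum_pos (mem_spectrum_of_eigen (hb j) (b.orthonormal.ne_zero j))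
  refine ⟨c, hpos, fun α => ?_, fun α => ?_, ?_, fun N hNB => ?_⟩
  · have hX := isSelfAdjoint_sub_smul hAs hBs α
    have hY : M * (A - α • B) * M = C - α • 1 := by
      rw [mul_sub, sub_mul, mul_smul_comm, smul_mul_assoc, hMBM]
    rw [projGT_eq, reTr_posProj, ← finrank_posSubspace_conj hX hM hN hMN hNM, hY, ← reTr_posProj,
      reTr_posProj_of_apply b (l := fun j => c j - α)
        (isSelfAdjoint_sub_smul hCs (IsSelfAdjoint.one _) α)]
    · simp only [sub_pos]
    · intro j
      rw [sub_apply, real_smul_apply, hb]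
      simp [sub_smul]
  · have hX := isSelfAdjoint_sub_smul hBs hAs α
    have hY : M * (B - α • A) * M = 1 - α • C := by
      rw [mul_sub, sub_mul, mul_smul_comm, smul_mul_assoc, hMBM]
    rw [projGT_eq, reTr_posProj, ← finrank_posSubspace_conj hX hM hN hMN hNM, hY, ← reTr_posProj,
      reTr_posProj_of_apply b (l := fun j => 1 - α * c j)
        (isSelfAdjoint_sub_smul (IsSelfAdjoint.one _) hCs α)]
    · simp only [sub_pos]
    · intro j
      rw [sub_apply, real_smul_apply, hb]
      rw [smul_smul, Complex.ofReal_sub, Complex.ofReal_mul, Complex.ofReal_one, sub_smul, one_smul]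
      rfl
  · have hd : ∀ X Y : E →L[ℂ] E, LinearMap.det ((X * Y : E →L[ℂ] E) : E →ₗ[ℂ] E)
        = LinearMap.det (X : E →ₗ[ℂ] E) * LinearMap.det (Y : E →ₗ[ℂ] E) :=
      fun X Y => LinearMap.det_comp _ _
    have h1 : LinearMap.det ((M * B * M : E →L[ℂ] E) : E →ₗ[ℂ] E) = 1 := by
      rw [hMBM]
      exact LinearMap.det_id
    rw [hd, hd] at h1
    rw [← det_eq_prod_of_apply b hb, hCdef, hd, hd]
    linear_combination LinearMap.det (A : E →ₗ[ℂ] E) * h1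
  · have h1 : N = M * M := by
      calc N = N * (B * M * M) := by rw [hNM, mul_one]
        _ = (N * B) * (M * M) := by simp only [mul_assoc]
        _ = M * M := by rw [hNB, one_mul]
    rw [← reTr_eq_sum_of_apply b hb, h1, hCdef, ← mul_assoc, reTr_mul_comm (A * M) M,
      mul_assoc]

/-! ### The layer integrals -/

lemma projGT_eq_zero_of_le {A B : E →L[ℂ] E} (h : A ≤ B) : projGT A B = 0 :=
  posProj_eq_zero_of_nonpos (sub_nonpos.mpr h)

lemma projGT_smul_self {A : E →L[ℂ] E} (hA : 0 ≤ A) {α : ℝ} (hα : 1 ≤ α) :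
    projGT A (α • A) = 0 := by
  refine projGT_eq_zero_of_le ?_
  calc A = (1 : ℝ) • A := (one_smul _ _).symm
    _ ≤ α • A := smul_le_smul_of_nonneg_right hα hA

lemma exists_projGT_eq_zero {A B : E →L[ℂ] E} (hA : IsStrictlyPositive A)
    (hB : IsStrictlyPositive B) : ∃ m : ℝ, ∀ α, m ≤ α → projGT A (α • B) = 0 := by
  obtain ⟨c, hc, h1, -⟩ := exists_pencil_eigenvalues hA hB
  -- the sum of the pencil eigenvalues bounds each of them, also in dimension zero
  refine ⟨∑ j, c j, fun α hα => ?_⟩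
  have h2 : reTr (projGT A (α • B)) = 0 := by
    rw [h1]
    refine Finset.sum_eq_zero fun j _ => if_neg (not_lt.mpr ?_)
    exact (Finset.single_le_sum (fun i _ => (hc i).le) (Finset.mem_univ j)).trans hα
  rw [projGT_eq, reTr_posProj, Nat.cast_eq_zero, Submodule.finrank_eq_zero] at h2
  simp only [projGT_eq, posProj, h2, Submodule.starProjection_bot]

lemma integrableOn_smul_projGT {A B : E →L[ℂ] E} (hA : IsStrictlyPositive A)
    (hB : IsStrictlyPositive B) {φ : ℝ → ℝ} (hφ : Measurable φ) (hb : ∀ α, 1 < α → |φ α| ≤ 1) :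
    IntegrableOn (fun α : ℝ => φ α • projGT A (α • B)) (Ioi 1) := by
  obtain ⟨m, hm⟩ := exists_projGT_eq_zero hA hB
  have hmeas : StronglyMeasurable fun α : ℝ => φ α • projGT A (α • B) := by
    refine hφ.stronglyMeasurable.smul ?_
    refine stronglyMeasurable_posProj (X := fun α : ℝ => A - α • B) (by fun_prop) fun α => ?_
    exact isSelfAdjoint_sub_smul hA.isSelfAdjoint hB.isSelfAdjoint α
  have h1 : IntegrableOn (fun α : ℝ => φ α • projGT A (α • B)) (Ioc 1 m) := by
    refine Measure.integrableOn_of_bounded (M := 1) measure_Ioc_lt_top.ne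
      hmeas.aestronglyMeasurable ?_
    filter_upwards [ae_restrict_mem measurableSet_Ioc] with α hα
    rw [norm_smul, Real.norm_eq_abs]
    exact mul_le_one₀ (hb α hα.1) (norm_nonneg _) (norm_projGT_le _ _)
  refine h1.of_forall_sdiff_eq_zero measurableSet_Ioi fun α hα => ?_
  have : m ≤ α := by
    by_contra! h
    exact hα.2 ⟨hα.1, h.le⟩
  rw [hm α this, smul_zero]

lemma abs_one_div_le_one {α : ℝ} (h : 1 < α) : |1 / α| ≤ 1 := by
  rw [abs_of_pos (by positivity), div_le_one (by linarith)]
  exact h.le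

lemma abs_one_div_sq_le_one {α : ℝ} (h : 1 < α) : |1 / α ^ 2| ≤ 1 := by
  rw [abs_of_pos (by positivity), div_le_one (by positivity)]
  nlinarith

lemma integrableOn_inv_smul_projGT {A B : E →L[ℂ] E} (hA : IsStrictlyPositive A)
    (hB : IsStrictlyPositive B) :
    IntegrableOn (fun α : ℝ => (1 / α) • projGT A (α • B)) (Ioi 1) :=
  integrableOn_smul_projGT hA hB (by fun_prop) fun _ => abs_one_div_le_one

lemma integrableOn_inv_sq_smul_projGT {A B : E →L[ℂ] E} (hA : IsStrictlyPositive A)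
    (hB : IsStrictlyPositive B) :
    IntegrableOn (fun α : ℝ => (1 / α ^ 2) • projGT A (α • B)) (Ioi 1) :=
  integrableOn_smul_projGT hA hB (by fun_prop) fun _ => abs_one_div_sq_le_one

lemma integrableOn_projGT {A B : E →L[ℂ] E} (hA : IsStrictlyPositive A)
    (hB : IsStrictlyPositive B) :
    IntegrableOn (fun α : ℝ => projGT A (α • B)) (Ioi 1) := by
  simpa using integrableOn_smul_projGT hA hB (φ := fun _ => 1) (by fun_prop) (by simp)

/-- The difference of layer integrals that represents `log A - log B`. -/
def layerLog (A B : E →L[ℂ] E) : E →L[ℂ] E :=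
  (∫ α in Ioi (1 : ℝ), (1 / α) • projGT A (α • B)) -
    ∫ α in Ioi (1 : ℝ), (1 / α) • projGT B (α • A)

/-- The gradient of `layerEntropy` in its second argument. -/
def layerGradRight (A B : E →L[ℂ] E) : E →L[ℂ] E :=
  (∫ α in Ioi (1 : ℝ), (1 / α ^ 2) • projGT B (α • A)) -
    ∫ α in Ioi (1 : ℝ), projGT A (α • B)

/-- The functional `∫₁^∞ Tr (A - α B)₊ dα / α + ∫₁^∞ Tr (B - α A)₊ dα / α²`. It is encoded through
its gradient by Euler's identity for homogeneous functions; `reTr_mul_layer` with `A' = A`, `B' = B`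
recovers the integral, the positive part being `X₊ = X {X > 0}`. -/
def layerEntropy (A B : E →L[ℂ] E) : ℝ :=
  reTr (A * layerLog A B + B * layerGradRight A B)

/-- The functional `X ↦ Re Tr (M X)`, as a continuous real-linear functional. -/
def reTrMul (M : E →L[ℂ] E) : (E →L[ℂ] E) →L[ℝ] ℝ :=
  reTr ∘L ContinuousLinearMap.mul ℝ (E →L[ℂ] E) M

lemma reTrMul_apply (M X : E →L[ℂ] E) : reTrMul M X = reTr (M * X) := rfl

/-- The pairing of a pair `(A', B')` with the gradient at `(A, B)`, as a single integral. -/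
lemma reTr_mul_layer {A B : E →L[ℂ] E} (hA : IsStrictlyPositive A) (hB : IsStrictlyPositive B)
    (A' B' : E →L[ℂ] E) :
    IntegrableOn (fun α : ℝ => 1 / α * reTr ((A' - α • B') * projGT A (α • B)) +
      1 / α ^ 2 * reTr ((B' - α • A') * projGT B (α • A))) (Ioi 1) ∧
    reTr (A' * layerLog A B + B' * layerGradRight A B) =
      ∫ α in Ioi (1 : ℝ), (1 / α * reTr ((A' - α • B') * projGT A (α • B)) +
        1 / α ^ 2 * reTr ((B' - α • A') * projGT B (α • A))) := by
  have i1 := integrableOn_inv_smul_projGT hA hB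
  have i2 := integrableOn_inv_smul_projGT hB hA
  have i3 := integrableOn_inv_sq_smul_projGT hB hA
  have i4 := integrableOn_projGT hA hB
  have j1 := (reTrMul A').integrable_comp i1
  have j2 := (reTrMul A').integrable_comp i2
  have j3 := (reTrMul B').integrable_comp i3
  have j4 := (reTrMul B').integrable_comp i4
  have hsum : reTr (A' * layerLog A B + B' * layerGradRight A B) =
      ∫ α in Ioi (1 : ℝ), ((reTrMul A' ((1 / α) • projGT A (α • B)) -
        reTrMul A' ((1 / α) • projGT B (α • A))) +
        (reTrMul B' ((1 / α ^ 2) • projGT B (α • A)) - reTrMul B' (projGT A (α • B)))) := by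
    have hadd := integral_add (j1.sub j2) (j3.sub j4)
    simp only [Pi.sub_apply] at hadd
    rw [hadd, integral_sub j1 j2, integral_sub j3 j4,
      (reTrMul A').integral_comp_comm i1, (reTrMul A').integral_comp_comm i2,
      (reTrMul B').integral_comp_comm i3, (reTrMul B').integral_comp_comm i4,
      ← map_sub, ← map_sub, reTrMul_apply, reTrMul_apply, ← map_add]
    rfl
  have hcongr : EqOn (fun α : ℝ => (reTrMul A' ((1 / α) • projGT A (α • B)) -
        reTrMul A' ((1 / α) • projGT B (α • A))) +
        (reTrMul B' ((1 / α ^ 2) • projGT B (α • A)) - reTrMul B' (projGT A (α • B))))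
      (fun α : ℝ => 1 / α * reTr ((A' - α • B') * projGT A (α • B)) +
        1 / α ^ 2 * reTr ((B' - α • A') * projGT B (α • A))) (Ioi 1) := by
    intro α hα
    have hα0 : α ≠ 0 := by
      have : (1 : ℝ) < α := hα
      positivity
    simp only [reTrMul_apply, map_smul, sub_mul, smul_mul_assoc, map_sub,
      smul_eq_mul]
    field_simp
    ring
  refine ⟨IntegrableOn.congr_fun ((j1.sub j2).add (j3.sub j4)) hcongr measurableSet_Ioi, ?_⟩
  rw [hsum]
  exact setIntegral_congr_fun measurableSet_Ioi hcongr

/-- The pair `(layerLog, layerGradRight)` is a subgradient of the positively homogeneous convex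
functional `layerEntropy`: replacing the spectral projections of `A' - α B'` by those of
`A - α B` can only decrease the trace. -/
lemma reTr_mul_layer_le_layerEntropy {A B A' B' : E →L[ℂ] E} (hA : IsStrictlyPositive A)
    (hB : IsStrictlyPositive B) (hA' : IsStrictlyPositive A') (hB' : IsStrictlyPositive B') :
    reTr (A' * layerLog A B + B' * layerGradRight A B) ≤ layerEntropy A' B' := by
  obtain ⟨i1, e1⟩ := reTr_mul_layer hA hB A' B'
  obtain ⟨i2, e2⟩ := reTr_mul_layer hA' hB' A' B'
  rw [layerEntropy, e1, e2]
  refine setIntegral_mono_on i1 i2 measurableSet_Ioi fun α hα => ?_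
  have hα0 : (0 : ℝ) < α := zero_lt_one.trans hα
  have h1 := reTr_mul_posProj_le (A - α • B)
    (isSelfAdjoint_sub_smul hA'.isSelfAdjoint hB'.isSelfAdjoint α)
  have h2 := reTr_mul_posProj_le (B - α • A)
    (isSelfAdjoint_sub_smul hB'.isSelfAdjoint hA'.isSelfAdjoint α)
  simp only [projGT_eq]
  gcongr

lemma layerLog_self {A : E →L[ℂ] E} : layerLog A A = 0 := sub_self _

lemma layerGradRight_self {A : E →L[ℂ] E} (hA : IsStrictlyPositive A) :
    layerGradRight A A = 0 := by
  have h : ∀ α ∈ Ioi (1 : ℝ), projGT A (α • A) = 0 := fun α hα =>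
    projGT_smul_self hA.nonneg (le_of_lt hα)
  rw [layerGradRight, setIntegral_eq_zero_of_forall_eq_zero fun α hα => by rw [h α hα, smul_zero],
    setIntegral_eq_zero_of_forall_eq_zero h, sub_self]

lemma layerEntropy_self {A : E →L[ℂ] E} (hA : IsStrictlyPositive A) : layerEntropy A A = 0 := by
  rw [layerEntropy, layerLog_self, layerGradRight_self hA, mul_zero, add_zero, map_zero]

lemma layerEntropy_nonneg {A B : E →L[ℂ] E} (hA : IsStrictlyPositive A)
    (hB : IsStrictlyPositive B) : 0 ≤ layerEntropy A B := by
  have h := reTr_mul_layer_le_layerEntropy hB hB hA hB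
  rwa [layerLog_self, layerGradRight_self hB, mul_zero, mul_zero, add_zero, map_zero] at h

/-! ### Traces of the layer integrals -/

lemma integral_mul_ite_lt {φ Φ : ℝ → ℝ} (hΦ : ∀ x, 0 < x → HasDerivAt Φ (φ x) x)
    (hφ : ContinuousOn φ (Ioi 0)) (c : ℝ) :
    IntegrableOn (fun α => φ α * if α < c then 1 else 0) (Ioi 1) ∧
      ∫ α in Ioi (1 : ℝ), (φ α * if α < c then 1 else 0) = if 1 < c then Φ c - Φ 1 else 0 := by
  have heq : (fun α => φ α * if α < c then (1 : ℝ) else 0) = (Iio c).indicator φ := by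
    ext α
    by_cases h : α < c <;> simp [h]
  have hsub : Icc 1 c ⊆ Ioi (0 : ℝ) := fun x hx => zero_lt_one.trans_le hx.1
  have hint : IntegrableOn φ (Ioo 1 c) :=
    ((hφ.mono hsub).integrableOn_Icc).mono_set Ioo_subset_Icc_self
  rw [heq]
  constructor
  · rw [IntegrableOn, integrable_indicator_iff measurableSet_Iio, IntegrableOn,
      Measure.restrict_restrict measurableSet_Iio, inter_comm, Ioi_inter_Iio]
    exact hint
  · rw [setIntegral_indicator measurableSet_Iio, Ioi_inter_Iio]
    split_ifs with h
    · rw [← integral_Ioc_eq_integral_Ioo, ← intervalIntegral.integral_of_le h.le]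
      refine intervalIntegral.integral_eq_sub_of_hasDerivAt (fun x hx => hΦ x ?_) ?_
      · rw [uIcc_of_le h.le] at hx
        exact hsub hx
      · rw [intervalIntegrable_iff_integrableOn_Ioc_of_le h.le]
        exact ((hφ.mono hsub).integrableOn_Icc).mono_set Ioc_subset_Icc_self
    · rw [Ioo_eq_empty h]
      simp

lemma reTr_integral_smul_projGT {A B : E →L[ℂ] E} {φ Φ : ℝ → ℝ}
    (hΦ : ∀ x, 0 < x → HasDerivAt Φ (φ x) x)
    (hφ : ContinuousOn φ (Ioi 0))
    (hi : IntegrableOn (fun α : ℝ => φ α • projGT A (α • B)) (Ioi 1)) {ι : Type*} [Fintype ι]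
    {c : ι → ℝ} (hc : ∀ α : ℝ, 0 < α → reTr (projGT A (α • B)) = ∑ j, if α < c j then 1 else 0) :
    reTr (∫ α in Ioi (1 : ℝ), φ α • projGT A (α • B)) =
      ∑ j, if 1 < c j then Φ (c j) - Φ 1 else 0 := by
  rw [← reTr.integral_comp_comm hi]
  rw [setIntegral_congr_fun (g := fun α => ∑ j, φ α * if α < c j then (1 : ℝ) else 0)
    measurableSet_Ioi fun α hα => ?_]
  · rw [integral_finsetSum _ fun j _ => (integral_mul_ite_lt hΦ hφ (c j)).1]
    exact Finset.sum_congr rfl fun j _ => (integral_mul_ite_lt hΦ hφ (c j)).2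
  · simp only [map_smul, smul_eq_mul]
    rw [hc α (zero_lt_one.trans hα), Finset.mul_sum]

lemma reTr_layer_eq_sum {A B : E →L[ℂ] E} (hA : IsStrictlyPositive A)
    (hB : IsStrictlyPositive B) {ι : Type*} [Fintype ι] {c : ι → ℝ} (hc0 : ∀ j, 0 < c j)
    (h1 : ∀ α : ℝ, reTr (projGT A (α • B)) = ∑ j, if α < c j then 1 else 0)
    (h2 : ∀ α : ℝ, reTr (projGT B (α • A)) = ∑ j, if α * c j < 1 then 1 else 0) :
    reTr (layerLog A B) = ∑ j, Real.log (c j) ∧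
      reTr (layerGradRight A B) = ∑ j, (1 - c j) := by
  have h2' : ∀ α : ℝ, 0 < α →
      reTr (projGT B (α • A)) = ∑ j, if α < (c j)⁻¹ then 1 else 0 := by
    intro α _
    rw [h2]
    refine Finset.sum_congr rfl fun j _ => if_congr ?_ rfl rfl
    rw [inv_eq_one_div, lt_div_iff₀ (hc0 j)]
  have d1 : ∀ x : ℝ, 0 < x → HasDerivAt Real.log (1 / x) x := fun x hx => by
    simpa using Real.hasDerivAt_log hx.ne'
  have d2 : ∀ x : ℝ, 0 < x → HasDerivAt (fun x : ℝ => -x⁻¹) (1 / x ^ 2) x := fun x hx => by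
    have := (hasDerivAt_inv hx.ne').neg
    rw [neg_neg, ← one_div] at this
    exact this
  have c1 : ContinuousOn (fun x : ℝ => 1 / x) (Ioi 0) :=
    continuousOn_const.div continuousOn_id fun x hx => ne_of_gt hx
  have c2 : ContinuousOn (fun x : ℝ => 1 / x ^ 2) (Ioi 0) :=
    continuousOn_const.div (by fun_prop) fun x hx => pow_ne_zero _ (ne_of_gt hx)
  constructor
  · rw [layerLog, map_sub,
      reTr_integral_smul_projGT d1 c1 (integrableOn_inv_smul_projGT hA hB) fun α _ => h1 α,
      reTr_integral_smul_projGT d1 c1 (integrableOn_inv_smul_projGT hB hA) h2',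
      ← Finset.sum_sub_distrib]
    refine Finset.sum_congr rfl fun j _ => ?_
    have hinv : 1 < (c j)⁻¹ ↔ c j < 1 := one_lt_inv₀ (hc0 j)
    simp only [hinv, Real.log_inv, Real.log_one]
    rcases lt_trichotomy (c j) 1 with h | h | h
    · simp [h, h.le]
    · simp [h]
    · simp [h, h.le]
  · have h3 := reTr_integral_smul_projGT (φ := fun _ => 1) (Φ := fun x => x)
      (fun x _ => hasDerivAt_id x) continuousOn_const
      (by simpa using integrableOn_projGT hA hB) fun α _ => h1 α
    simp only [one_smul] at h3
    rw [layerGradRight, map_sub, h3,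
      reTr_integral_smul_projGT d2 c2 (integrableOn_inv_sq_smul_projGT hB hA) h2',
      ← Finset.sum_sub_distrib]
    refine Finset.sum_congr rfl fun j _ => ?_
    have hinv : 1 < (c j)⁻¹ ↔ c j < 1 := one_lt_inv₀ (hc0 j)
    simp only [hinv, inv_inv, inv_one]
    rcases lt_trichotomy (c j) 1 with h | h | h
    · rw [if_pos h, if_neg (not_lt.mpr h.le)]
      ring
    · simp [h]
    · rw [if_pos h, if_neg (not_lt.mpr h.le)]
      ring

/-- The trace of the gradient of `layerEntropy` in closed form. -/
lemma reTr_layerLog_add_layerGradRight {A B : E →L[ℂ] E} (hA : IsStrictlyPositive A)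
    (hB : IsStrictlyPositive B) {ι : Type*} [Fintype ι] {a b : ι → ℝ}
    (ha : ∀ i, 0 < a i) (hb : ∀ i, 0 < b i)
    (u v : OrthonormalBasis ι ℂ E) (hu : ∀ i, A (u i) = (a i : ℂ) • u i)
    (hv : ∀ i, B (v i) = (b i : ℂ) • v i) :
    reTr (layerLog A B) + reTr (layerGradRight A B) =
      ∑ i, Real.log (a i) - ∑ i, Real.log (b i) +
        ∑ i, (1 - (b i)⁻¹ * (⟪v i, A (v i)⟫_ℂ).re) := by
  obtain ⟨c, hc, h1, h2, h3, h4⟩ := exists_pencil_eigenvalues hA hB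
  obtain ⟨e1, e2⟩ := reTr_layer_eq_sum hA hB hc h1 h2
  obtain ⟨U, hU⟩ := hB.isUnit
  have hNB : (↑U⁻¹ : E →L[ℂ] E) * B = 1 := by rw [← hU, Units.inv_mul]
  have hN : ∀ i, (↑U⁻¹ : E →L[ℂ] E) (v i) = (((b i)⁻¹ : ℝ) : ℂ) • v i := fun i => by
    have h5 : (↑U⁻¹ : E →L[ℂ] E) (B (v i)) = v i := by
      rw [← mul_apply_eq_comp, hNB]
      rfl
    rw [hv, map_smul] at h5
    conv_rhs => rw [← h5]
    rw [smul_smul, ← Complex.ofReal_mul, inv_mul_cancel₀ (hb i).ne', Complex.ofReal_one, one_smul]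
  have hsum : ∑ j, c j = ∑ i, (b i)⁻¹ * (⟪v i, A (v i)⟫_ℂ).re := by
    rw [← h4 _ hNB, reTr_mul_eq_sum_of_apply v hN]
  have hlog : ∑ j, Real.log (c j) = ∑ i, Real.log (a i) - ∑ i, Real.log (b i) := by
    rw [det_eq_prod_of_apply u hu, det_eq_prod_of_apply v hv] at h3
    have h6 : (∏ j, c j) * ∏ i, b i = ∏ i, a i := by exact_mod_cast h3
    rw [← Real.log_prod fun i _ => (hc i).ne', ← Real.log_prod fun i _ => (ha i).ne',
      ← Real.log_prod fun i _ => (hb i).ne', ← h6, Real.log_mul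
      (Finset.prod_ne_zero_iff.mpr fun i _ => (hc i).ne')
      (Finset.prod_ne_zero_iff.mpr fun i _ => (hb i).ne')]
    ring
  have hcard : Fintype.card (Fin (Module.finrank ℂ E)) = Fintype.card ι := by
    rw [Fintype.card_fin, Module.finrank_eq_card_basis v.toBasis]
  rw [e1, e2, hlog, Finset.sum_sub_distrib, hsum, Finset.sum_sub_distrib]
  simp only [Finset.sum_const, Finset.card_univ, hcard]

/-! ### Closed form of the layer entropy -/

/-- The real number `D(A‖B) - Tr A + Tr B`, which is the Umegaki relative entropy normalised to
be nonnegative for operators of arbitrary trace. -/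
def umegaki (A B : E →L[ℂ] E) : ℝ :=
  reTr (A * (CFC.log A - CFC.log B)) - reTr A + reTr B

lemma umegaki_eq_sum {A B : E →L[ℂ] E} (hA : IsSelfAdjoint A) (hB : IsSelfAdjoint B)
    {ι : Type*} [Fintype ι] {a b : ι → ℝ} (u v : OrthonormalBasis ι ℂ E)
    (hu : ∀ i, A (u i) = (a i : ℂ) • u i) (hv : ∀ i, B (v i) = (b i : ℂ) • v i) :
    umegaki A B = ∑ i, a i * Real.log (a i) -
      ∑ i, (⟪v i, A (v i)⟫_ℂ).re * Real.log (b i) - ∑ i, a i + ∑ i, b i := by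
  rw [umegaki, mul_sub, map_sub, reTr_mul_eq_sum_of_apply u fun i => log_apply_of_eigen hA (hu i),
    reTr_mul_eq_sum_of_apply v fun i => log_apply_of_eigen hB (hv i), reTr_eq_sum_of_apply u hu,
    reTr_eq_sum_of_apply v hv]
  congr 3
  · refine Finset.sum_congr rfl fun i _ => ?_
    rw [hu, re_inner_basis_smul, mul_comm]
  · exact Finset.sum_congr rfl fun i _ => mul_comm _ _

lemma isStrictlyPositive_add_smul_one {A : E →L[ℂ] E} (hA : IsStrictlyPositive A) {s : ℝ}
    (hs : 0 ≤ s) : IsStrictlyPositive (A + s • (1 : E →L[ℂ] E)) :=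
  hA.add_nonneg (smul_nonneg hs zero_le_one)

lemma add_smul_one_apply {A : E →L[ℂ] E} {v : E} {r : ℝ} (hv : A v = (r : ℂ) • v) (s : ℝ) :
    (A + s • (1 : E →L[ℂ] E)) v = ((r + s : ℝ) : ℂ) • v := by
  rw [add_apply, real_smul_apply, hv, Complex.ofReal_add, add_smul]
  rfl

/-- A function with a subgradient that varies continuously is differentiable. -/
lemma hasDerivWithinAt_of_subgradient {G g : ℝ → ℝ} {S : Set ℝ}
    (hG : ∀ s ∈ S, ∀ t ∈ S, G s + (t - s) * g s ≤ G t) {s : ℝ} (hs : s ∈ S)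
    (hg : ContinuousWithinAt g S s) : HasDerivWithinAt G (g s) S s := by
  rw [hasDerivWithinAt_iff_isLittleO, Asymptotics.isLittleO_iff]
  intro ε hε
  have h1 := Metric.continuousWithinAt_iff'.mp hg ε hε
  filter_upwards [h1, self_mem_nhdsWithin] with t ht htS
  -- the two subgradient inequalities sandwich the remainder by `(g t - g s) (t - s)`
  have h2 := hG s hs t htS
  have h3 := hG t htS s hs
  rw [Real.dist_eq] at ht
  rw [smul_eq_mul, Real.norm_eq_abs, Real.norm_eq_abs]
  calc |G t - G s - (t - s) * g s| = G t - G s - (t - s) * g s := abs_of_nonneg (by linarith)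
    _ ≤ (g t - g s) * (t - s) := by linarith
    _ ≤ |(g t - g s) * (t - s)| := le_abs_self _
    _ = |g t - g s| * |t - s| := abs_mul _ _
    _ ≤ ε * |t - s| := by gcongr

/-- After a shift by `s` the integrand is supported in `α ≤ 1 + ‖A‖ / s`, because
`A + s ≤ (1 + ‖A‖ / s) s ≤ (1 + ‖A‖ / s) (B + s)`. -/
lemma norm_integral_projGT_shift_le {A B : E →L[ℂ] E} (hA : IsStrictlyPositive A)
    (hB : IsStrictlyPositive B) {s : ℝ} (hs : 0 < s) :
    ‖∫ α in Ioi (1 : ℝ), (1 / α) • projGT (A + s • 1) (α • (B + s • 1))‖ ≤ ‖A‖ / s := by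
  have hz : ∀ α, 1 + ‖A‖ / s ≤ α → projGT (A + s • 1) (α • (B + s • 1)) = 0 := by
    intro α hα
    refine projGT_eq_zero_of_le ?_
    have hα0 : 0 ≤ α := le_trans (by positivity) hα
    calc A + s • (1 : E →L[ℂ] E) ≤ ‖A‖ • (1 : E →L[ℂ] E) + s • 1 := by
          gcongr
          rw [← Algebra.algebraMap_eq_smul_one]
          exact IsSelfAdjoint.le_algebraMap_norm_self hA.isSelfAdjoint
      _ = ((1 + ‖A‖ / s) * s) • (1 : E →L[ℂ] E) := by
          rw [← add_smul]
          congr 1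
          field_simp
          ring
      _ ≤ (α * s) • (1 : E →L[ℂ] E) :=
          smul_le_smul_of_nonneg_right (by gcongr) zero_le_one
      _ ≤ (α * s) • (1 : E →L[ℂ] E) + α • B := le_add_of_nonneg_right (smul_nonneg hα0 hB.nonneg)
      _ = α • (B + s • 1) := by rw [smul_add, smul_smul, add_comm]
  have hle : (1 : ℝ) ≤ 1 + ‖A‖ / s := le_add_of_nonneg_right (by positivity)
  rw [setIntegral_eq_of_subset_of_forall_sdiff_eq_zero (s := Ioc 1 (1 + ‖A‖ / s))
    measurableSet_Ioi Ioc_subset_Ioi_self fun α hα => ?_]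
  · refine (norm_setIntegral_le_of_norm_le_const (C := 1) measure_Ioc_lt_top fun α hα => ?_).trans ?_
    · rw [norm_smul, Real.norm_eq_abs]
      exact mul_le_one₀ (abs_one_div_le_one hα.1) (norm_nonneg _) (norm_projGT_le _ _)
    · rw [Real.volume_real_Ioc_of_le hle]
      linarith
  · rw [hz α, smul_zero]
    by_contra! h
    exact hα.2 ⟨hα.1, h.le⟩

/-- The subgradient inequality at `(A + s, B + s)`, tested at `(B + s, B + s)` where the functional
vanishes, gives `layerEntropy (A + s) (B + s) ≤ Tr (A - B) R` with `R` the shifted `layerLog`, and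
`R` tends to `0`. -/
lemma tendsto_layerEntropy_shift {A B : E →L[ℂ] E} (hA : IsStrictlyPositive A)
    (hB : IsStrictlyPositive B) :
    Tendsto (fun s : ℝ => layerEntropy (A + s • 1) (B + s • 1)) atTop (𝓝 0) := by
  have hbound : Tendsto (fun s : ℝ => ‖reTrMul (A - B)‖ * (‖A‖ / s + ‖B‖ / s)) atTop (𝓝 0) := by
    have h := ((tendsto_const_nhds (x := ‖A‖)).div_atTop (tendsto_id (α := ℝ))).add
      ((tendsto_const_nhds (x := ‖B‖)).div_atTop (tendsto_id (α := ℝ)))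
    simpa using h.const_mul ‖reTrMul (A - B)‖
  refine tendsto_of_tendsto_of_tendsto_of_le_of_le' tendsto_const_nhds hbound ?_ ?_
  · filter_upwards [eventually_ge_atTop 0] with s hs
    exact layerEntropy_nonneg (isStrictlyPositive_add_smul_one hA hs)
      (isStrictlyPositive_add_smul_one hB hs)
  · filter_upwards [eventually_gt_atTop 0] with s hs
    have hAs := isStrictlyPositive_add_smul_one hA hs.le
    have hBs := isStrictlyPositive_add_smul_one hB hs.le
    have h1 := reTr_mul_layer_le_layerEntropy hAs hBs hBs hBs
    rw [layerEntropy_self hBs] at h1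
    have h2 : layerEntropy (A + s • 1) (B + s • 1) =
        reTrMul (A - B) (layerLog (A + s • 1) (B + s • 1)) +
        reTr ((B + s • 1) * layerLog (A + s • 1) (B + s • 1) +
          (B + s • 1) * layerGradRight (A + s • 1) (B + s • 1)) := by
      rw [layerEntropy, reTrMul_apply, ← map_add]
      congr 1
      noncomm_ring
    calc layerEntropy (A + s • 1) (B + s • 1)
        ≤ reTrMul (A - B) (layerLog (A + s • 1) (B + s • 1)) := by linarith
      _ ≤ ‖reTrMul (A - B) (layerLog (A + s • 1) (B + s • 1))‖ := Real.le_norm_self _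
      _ ≤ ‖reTrMul (A - B)‖ * ‖layerLog (A + s • 1) (B + s • 1)‖ :=
          ContinuousLinearMap.le_opNorm _ _
      _ ≤ ‖reTrMul (A - B)‖ * (‖A‖ / s + ‖B‖ / s) := by
          gcongr
          exact (norm_sub_le _ _).trans (add_le_add (norm_integral_projGT_shift_le hA hB hs)
            (norm_integral_projGT_shift_le hB hA hs))

lemma tendsto_add_mul_log_one_add_div (k b : ℝ) :
    Tendsto (fun s : ℝ => (k + s) * Real.log (1 + b / s)) atTop (𝓝 b) := by
  have h1 : Tendsto (fun s : ℝ => Real.log (1 + b / s)) atTop (𝓝 0) := by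
    have h2 : Tendsto (fun s : ℝ => 1 + b / s) atTop (𝓝 (1 + 0)) :=
      tendsto_const_nhds.add ((tendsto_const_nhds (x := b)).div_atTop tendsto_id)
    rw [add_zero] at h2
    simpa using h2.log one_ne_zero
  have h3 := (h1.const_mul k).add (Real.tendsto_mul_log_one_add_div_atTop b)
  rw [mul_zero, zero_add] at h3
  exact h3.congr fun s => (add_mul _ _ _).symm

/-- `layerEntropy` and `umegaki` have the same derivative along the path `(A + s, B + s)`, and both
vanish at `s = ∞`. -/
theorem layerEntropy_eq_umegaki {A B : E →L[ℂ] E} (hA : IsStrictlyPositive A)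
    (hB : IsStrictlyPositive B) : layerEntropy A B = umegaki A B := by
  obtain ⟨u, a, hu⟩ := exists_eigenbasis hA.isSelfAdjoint
  obtain ⟨v, b, hv⟩ := exists_eigenbasis hB.isSelfAdjoint
  have ha : ∀ i, 0 < a i := fun j =>
    hA.spectrum_pos (mem_spectrum_of_eigen (hu j) (u.orthonormal.ne_zero j))
  have hb : ∀ i, 0 < b i := fun j =>
    hB.spectrum_pos (mem_spectrum_of_eigen (hv j) (v.orthonormal.ne_zero j))
  set k : Fin (Module.finrank ℂ E) → ℝ := fun i => (⟪v i, A (v i)⟫_ℂ).re with hk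
  have hksum : ∑ i, k i = ∑ i, a i := by
    rw [← reTr_eq_sum_of_apply u hu, reTr_eq_sum v]
  have hkshift : ∀ s : ℝ, ∀ i, (⟪v i, (A + s • (1 : E →L[ℂ] E)) (v i)⟫_ℂ).re = k i + s := by
    intro s i
    rw [add_apply, real_smul_apply, inner_add_right, Complex.add_re]
    congr 1
    exact re_inner_basis_smul v i s
  set G : ℝ → ℝ := fun s => layerEntropy (A + s • 1) (B + s • 1) with hGdef
  set T : ℝ → ℝ := fun s => ∑ i, (a i + s) * Real.log (a i + s) -
      ∑ i, (k i + s) * Real.log (b i + s) - ∑ i, a i + ∑ i, b i with hTdef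
  set g : ℝ → ℝ := fun s => ∑ i, Real.log (a i + s) - ∑ i, Real.log (b i + s) +
      ∑ i, (1 - (b i + s)⁻¹ * (k i + s)) with hgdef
  have hT : ∀ s, 0 ≤ s → umegaki (A + s • 1) (B + s • 1) = T s := by
    intro s hs
    rw [umegaki_eq_sum (isStrictlyPositive_add_smul_one hA hs).isSelfAdjoint
      (isStrictlyPositive_add_smul_one hB hs).isSelfAdjoint u v
      (fun i => add_smul_one_apply (hu i) s) (fun i => add_smul_one_apply (hv i) s)]
    simp only [hkshift, hTdef, Finset.sum_add_distrib]
    ring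
  have hg : ∀ s, 0 ≤ s → reTr (layerLog (A + s • 1) (B + s • 1)) +
      reTr (layerGradRight (A + s • 1) (B + s • 1)) = g s := by
    intro s hs
    rw [reTr_layerLog_add_layerGradRight (isStrictlyPositive_add_smul_one hA hs)
      (isStrictlyPositive_add_smul_one hB hs) (a := fun i => a i + s) (b := fun i => b i + s)
      (fun i => add_pos_of_pos_of_nonneg (ha i) hs) (fun i => add_pos_of_pos_of_nonneg (hb i) hs)
      u v (fun i => add_smul_one_apply (hu i) s) (fun i => add_smul_one_apply (hv i) s)]
    simp only [hkshift, hgdef]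
  have hsub : ∀ s ∈ Ici (0 : ℝ), ∀ t ∈ Ici (0 : ℝ), G s + (t - s) * g s ≤ G t := by
    intro s hs t ht
    have h := reTr_mul_layer_le_layerEntropy (isStrictlyPositive_add_smul_one hA hs)
      (isStrictlyPositive_add_smul_one hB hs) (isStrictlyPositive_add_smul_one hA ht)
      (isStrictlyPositive_add_smul_one hB ht)
    refine le_trans (le_of_eq ?_) h
    rw [← hg s hs]
    simp only [hGdef, layerEntropy, map_add, add_mul, smul_mul_assoc, one_mul, map_smul,
      smul_eq_mul]
    ring
  have hpos : ∀ {r s : ℝ}, 0 < r → s ∈ Ici (0 : ℝ) → r + s ≠ 0 := fun hr hs =>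
    (add_pos_of_pos_of_nonneg hr hs).ne'
  have hgc : ContinuousOn g (Ici 0) := by
    refine ((continuousOn_finsetSum _ fun i _ => ?_).sub
      (continuousOn_finsetSum _ fun i _ => ?_)).add (continuousOn_finsetSum _ fun i _ => ?_)
    · exact ContinuousOn.log (by fun_prop) fun s hs => hpos (ha i) hs
    · exact ContinuousOn.log (by fun_prop) fun s hs => hpos (hb i) hs
    · exact continuousOn_const.sub
        ((ContinuousOn.inv₀ (by fun_prop) fun s hs => hpos (hb i) hs).mul (by fun_prop))
  have hGd : ∀ s ∈ Ici (0 : ℝ), HasDerivWithinAt G (g s) (Ici 0) s := fun s hs =>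
    hasDerivWithinAt_of_subgradient hsub hs (hgc s hs)
  have hTd : ∀ s ∈ Ici (0 : ℝ), HasDerivWithinAt T (g s) (Ici 0) s := by
    intro s hs
    have hid : ∀ r : ℝ, HasDerivAt (fun s : ℝ => r + s) 1 s := fun r =>
      (hasDerivAt_id s).const_add r
    have d1 : ∀ i, HasDerivAt (fun s => (a i + s) * Real.log (a i + s))
        (Real.log (a i + s) + 1) s := fun i => by
      have h := (hid (a i)).mul ((hid (a i)).log (hpos (ha i) hs))
      have e : 1 * Real.log (a i + s) + (a i + s) * (1 / (a i + s)) =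
          Real.log (a i + s) + 1 := by
        field_simp [hpos (ha i) hs]
      rw [e] at h
      exact h
    have d2 : ∀ i, HasDerivAt (fun s => (k i + s) * Real.log (b i + s))
        (Real.log (b i + s) + (b i + s)⁻¹ * (k i + s)) s := fun i => by
      have h := (hid (k i)).mul ((hid (b i)).log (hpos (hb i) hs))
      have e : 1 * Real.log (b i + s) + (k i + s) * (1 / (b i + s)) =
          Real.log (b i + s) + (b i + s)⁻¹ * (k i + s) := by
        ring
      rw [e] at h
      exact h
    have h := (((HasDerivAt.fun_sum fun i (_ : i ∈ Finset.univ) => d1 i).sub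
      (HasDerivAt.fun_sum fun i (_ : i ∈ Finset.univ) => d2 i)).sub_const
        (∑ i, a i)).add_const (∑ i, b i)
    have e : ∑ i, (Real.log (a i + s) + 1) -
        ∑ i, (Real.log (b i + s) + (b i + s)⁻¹ * (k i + s)) = g s := by
      simp only [hgdef, Finset.sum_add_distrib, Finset.sum_sub_distrib]
      ring
    rw [e] at h
    exact h.hasDerivWithinAt
  have hconst : ∀ s, 0 ≤ s → G s - T s = G 0 - T 0 := by
    intro s hs
    refine constant_of_has_deriv_right_zero (f := fun s => G s - T s) (a := 0) (b := s)
      (fun x hx => ?_) (fun x hx => ?_) s ⟨hs, le_rfl⟩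
    · exact (((hGd x hx.1).sub (hTd x hx.1)).continuousWithinAt).mono Icc_subset_Ici_self
    · have h := ((hGd x hx.1).sub (hTd x hx.1)).mono (Ici_subset_Ici.mpr hx.1)
      rw [sub_self] at h
      exact h
  have hTlim : Tendsto T atTop (𝓝 0) := by
    have h : Tendsto (fun s : ℝ => ∑ i, (a i + s) * Real.log (1 + a i / s) -
        ∑ i, (k i + s) * Real.log (1 + b i / s) - ∑ i, a i + ∑ i, b i) atTop
        (𝓝 (∑ i, a i - ∑ i, b i - ∑ i, a i + ∑ i, b i)) :=
      (((tendsto_finsetSum _ fun i _ => tendsto_add_mul_log_one_add_div (a i) (a i)).sub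
        (tendsto_finsetSum _ fun i _ => tendsto_add_mul_log_one_add_div (k i) (b i))).sub_const
        _).add_const _
    have e : ∑ i, a i - ∑ i, b i - ∑ i, a i + ∑ i, b i = 0 := by ring
    rw [e] at h
    refine h.congr' ?_
    filter_upwards [eventually_gt_atTop 0] with s hs
    have hl : ∀ r, 0 < r → Real.log (r + s) = Real.log (1 + r / s) + Real.log s := by
      intro r hr
      rw [← Real.log_mul (by positivity) hs.ne']
      congr 1
      field_simp
      ring
    -- the terms with `log s` cancel because `∑ k = Tr A = ∑ a`
    have hcancel : ∑ i, (a i + s) * Real.log s = ∑ i, (k i + s) * Real.log s := by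
      rw [← Finset.sum_mul, ← Finset.sum_mul, Finset.sum_add_distrib, Finset.sum_add_distrib, hksum]
    simp only [hTdef, hl _ (ha _), hl _ (hb _), mul_add, Finset.sum_add_distrib]
    linarith
  have hGlim : Tendsto G atTop (𝓝 0) := tendsto_layerEntropy_shift hA hB
  have hlim : Tendsto (fun s => G s - T s) atTop (𝓝 (G 0 - T 0)) := by
    refine tendsto_const_nhds.congr' ?_
    filter_upwards [eventually_ge_atTop 0] with s hs
    exact (hconst s hs).symm
  have h0 : G 0 - T 0 = 0 := by
    have := tendsto_nhds_unique hlim (hGlim.sub hTlim)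
    simpa using this
  rw [← hT 0 le_rfl] at h0
  simp only [hGdef, zero_smul, add_zero] at h0
  linarith

/-! ### The operator identity -/

lemma eventually_isStrictlyPositive_add_smul {A K : E →L[ℂ] E} (hA : IsStrictlyPositive A)
    (hK : IsSelfAdjoint K) : ∀ᶠ t : ℝ in 𝓝[>] 0, IsStrictlyPositive (A + t • K) := by
  rcases subsingleton_or_nontrivial (E →L[ℂ] E) with hs | hn
  · exact Eventually.of_forall fun t => IsStrictlyPositive.of_subsingleton
  obtain ⟨δ, hδ, hle⟩ := (CFC.exists_pos_algebraMap_le_iff hA.isSelfAdjoint).mpr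
    fun x hx => hA.spectrum_pos hx
  have hlim : Tendsto (fun t : ℝ => δ - t * ‖K‖) (𝓝[>] 0) (𝓝 δ) := by
    have : Tendsto (fun t : ℝ => δ - t * ‖K‖) (𝓝 0) (𝓝 (δ - 0 * ‖K‖)) :=
      (by fun_prop : Continuous fun t : ℝ => δ - t * ‖K‖).tendsto 0
    rw [zero_mul, sub_zero] at this
    exact this.mono_left nhdsWithin_le_nhds
  filter_upwards [hlim.eventually_const_lt hδ, self_mem_nhdsWithin] with t ht ht0
  have ht0' : (0 : ℝ) ≤ t := le_of_lt ht0
  have h1 : IsStrictlyPositive (algebraMap ℝ (E →L[ℂ] E) (δ - t * ‖K‖)) :=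
    (isStrictlyPositive_algebraMap ht)
  refine h1.of_le ?_
  have h2 := IsSelfAdjoint.neg_algebraMap_norm_le_self hK
  calc algebraMap ℝ (E →L[ℂ] E) (δ - t * ‖K‖)
      = algebraMap ℝ (E →L[ℂ] E) δ + t • (-(algebraMap ℝ (E →L[ℂ] E) ‖K‖)) := by
        simp only [Algebra.algebraMap_eq_smul_one, sub_smul, smul_neg, smul_smul]
        abel
    _ ≤ A + t • K := add_le_add hle (smul_le_smul_of_nonneg_left h2 ht0')

lemma isSelfAdjoint_setIntegral_projGT (A B : E →L[ℂ] E) (φ : ℝ → ℝ) (S : Set ℝ) :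
    IsSelfAdjoint (∫ α in S, φ α • projGT A (α • B)) := by
  rw [isSelfAdjoint_iff]
  have h := (starL' ℝ (A := E →L[ℂ] E)).integral_comp_comm (μ := volume.restrict S)
    (fun α => φ α • projGT A (α • B))
  simp only [starL'_apply, star_smul, star_trivial] at h
  rw [← h]
  have hp : ∀ α : ℝ, star (projGT A (α • B)) = projGT A (α • B) := fun α =>
    (isSelfAdjoint_starProjection _).star_eq
  simp only [hp]

lemma isSelfAdjoint_layerLog (A B : E →L[ℂ] E) : IsSelfAdjoint (layerLog A B) :=
  (isSelfAdjoint_setIntegral_projGT A B (fun α => 1 / α) _).sub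
    (isSelfAdjoint_setIntegral_projGT B A (fun α => 1 / α) _)

/-- `layerLog A B` is a subgradient of `umegaki · B` at `A`, and Klein's inequality
`umegaki A A' ≥ 0` bounds the increment of `umegaki · B` from above. -/
lemma reTr_sub_mul_layerLog_le {A B A' : E →L[ℂ] E} (hA : IsStrictlyPositive A)
    (hB : IsStrictlyPositive B) (hA' : IsStrictlyPositive A') :
    reTr ((A' - A) * layerLog A B) ≤ reTr ((A' - A) * (CFC.log A' - CFC.log B)) := by
  have h1 := reTr_mul_layer_le_layerEntropy hA hB hA' hB
  have h2 := layerEntropy_nonneg hA hA'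
  have h3 := layerEntropy_eq_umegaki hA hB
  rw [layerEntropy] at h3
  rw [layerEntropy_eq_umegaki hA' hB] at h1
  rw [layerEntropy_eq_umegaki hA hA'] at h2
  simp only [umegaki, mul_sub, sub_mul, map_sub, map_add] at *
  linarith

lemma eq_zero_of_reTr_mul_self_nonpos {D : E →L[ℂ] E} (hD : IsSelfAdjoint D)
    (h : reTr (D * D) ≤ 0) : D = 0 := by
  obtain ⟨b, l, hb⟩ := exists_eigenbasis hD
  have h1 : reTr (D * D) = ∑ i, l i * l i := by
    rw [reTr_mul_eq_sum_of_apply b hb]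
    exact Finset.sum_congr rfl fun i _ => by rw [hb, re_inner_basis_smul]
  have h2 : ∀ i ∈ Finset.univ, l i * l i = 0 := by
    rw [← Finset.sum_eq_zero_iff_of_nonneg fun i _ => mul_self_nonneg _]
    exact le_antisymm (h1 ▸ h) (Finset.sum_nonneg fun i _ => mul_self_nonneg _)
  refine ext_of_basis b fun i => ?_
  rw [hb, mul_self_eq_zero.mp (h2 i (Finset.mem_univ i))]
  simp

/-- The operator layer cake identity. -/
theorem layerLog_eq {A B : E →L[ℂ] E} (hA : IsStrictlyPositive A) (hB : IsStrictlyPositive B) :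
    layerLog A B = CFC.log A - CFC.log B := by
  set D := layerLog A B - (CFC.log A - CFC.log B) with hDdef
  have hD : IsSelfAdjoint D :=
    (isSelfAdjoint_layerLog A B).sub (IsSelfAdjoint.log.sub IsSelfAdjoint.log)
  have hev := eventually_isStrictlyPositive_add_smul hA hD
  -- move `A` in the direction of the discrepancy `D` itself
  have hle : ∀ᶠ t : ℝ in 𝓝[>] 0,
      reTr (D * layerLog A B) ≤ reTr (D * (CFC.log (A + t • D) - CFC.log B)) := by
    filter_upwards [hev, self_mem_nhdsWithin] with t ht ht0
    have h := reTr_sub_mul_layerLog_le hA hB ht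
    rw [add_sub_cancel_left, smul_mul_assoc, smul_mul_assoc, map_smul, map_smul, smul_eq_mul,
      smul_eq_mul] at h
    exact le_of_mul_le_mul_left h ht0
  have hpath : Tendsto (fun t : ℝ => A + t • D) (𝓝[>] 0)
      (𝓝[{a | IsSelfAdjoint a ∧ IsUnit a}] A) := by
    refine tendsto_nhdsWithin_iff.mpr ⟨?_, hev.mono fun t ht => ⟨ht.isSelfAdjoint, ht.isUnit⟩⟩
    have : Tendsto (fun t : ℝ => A + t • D) (𝓝 0) (𝓝 (A + (0 : ℝ) • D)) :=
      (by fun_prop : Continuous fun t : ℝ => A + t • D).tendsto 0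
    rw [zero_smul, add_zero] at this
    exact this.mono_left nhdsWithin_le_nhds
  have hlog : Tendsto (fun t : ℝ => CFC.log (A + t • D)) (𝓝[>] 0) (𝓝 (CFC.log A)) :=
    (CFC.continuousOn_log A ⟨hA.isSelfAdjoint, hA.isUnit⟩).tendsto.comp hpath
  have hlim : Tendsto (fun t : ℝ => reTr (D * (CFC.log (A + t • D) - CFC.log B))) (𝓝[>] 0)
      (𝓝 (reTr (D * (CFC.log A - CFC.log B)))) :=
    ((reTrMul D).continuous.tendsto _).comp (hlog.sub_const _)
  have h := ge_of_tendsto hlim hle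
  have hDD : reTr (D * D) ≤ 0 := by
    have : reTr (D * D) = reTr (D * layerLog A B) - reTr (D * (CFC.log A - CFC.log B)) := by
      rw [← map_sub, ← mul_sub]
    linarith
  exact sub_eq_zero.mp (eq_zero_of_reTr_mul_self_nonpos hD hDD)

end LayerCake

end

theorem proposition4p1 {E : Type*} [NormedAddCommGroup E] [InnerProductSpace ℂ E]
    [FiniteDimensional ℂ E] [CompleteSpace E] (A B : E →L[ℂ] E)
    (hA : IsStrictlyPositive A) (hB : IsStrictlyPositive B) :
    (IntegrableOn (fun α : ℝ => (1 / α) • LayerCake.projGT A (α • B)) (Ioi 1) volume ∧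
      IntegrableOn (fun α : ℝ => (1 / α) • LayerCake.projGT B (α • A)) (Ioi 1) volume ∧
      CFC.log A - CFC.log B =
        (∫ α in Ioi (1 : ℝ), (1 / α) • LayerCake.projGT A (α • B)) -
          ∫ α in Ioi (1 : ℝ), (1 / α) • LayerCake.projGT B (α • A)) ∧
    (IntegrableOn (fun γ : ℝ => (1 / γ) • LayerCake.opTrace
        (A * (LayerCake.projGT A (γ • B) - LayerCake.projGT B (γ • A)))) (Ioi 1) volume ∧
      LayerCake.relEntropy A B =
        ∫ γ in Ioi (1 : ℝ), (1 / γ) • LayerCake.opTrace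
          (A * (LayerCake.projGT A (γ • B) - LayerCake.projGT B (γ • A)))) := by
  have i1 := LayerCake.integrableOn_inv_smul_projGT hA hB
  have i2 := LayerCake.integrableOn_inv_smul_projGT hB hA
  have hlog := LayerCake.layerLog_eq hA hB
  set L : (E →L[ℂ] E) →L[ℝ] ℂ :=
    (LayerCake.opTraceL ∘L ContinuousLinearMap.mul ℂ (E →L[ℂ] E) A).restrictScalars ℝ
  have hLapp : ∀ X, L X = LayerCake.opTrace (A * X) := fun X => rfl
  have hint : (fun γ : ℝ => (1 / γ) • LayerCake.opTrace
      (A * (LayerCake.projGT A (γ • B) - LayerCake.projGT B (γ • A)))) =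
      fun γ : ℝ => L ((1 / γ) • LayerCake.projGT A (γ • B) -
        (1 / γ) • LayerCake.projGT B (γ • A)) := by
    ext γ
    rw [← smul_sub, map_smul, hLapp]
  refine ⟨⟨i1, i2, hlog.symm⟩, ?_, ?_⟩
  · rw [hint]
    exact L.integrable_comp (i1.sub i2)
  · have hcomm := L.integral_comp_comm (i1.sub i2)
    simp only [Pi.sub_apply] at hcomm
    rw [hint, hcomm, integral_sub i1 i2]
    exact congrArg (fun X => LayerCake.opTrace (A * X)) hlog.symm
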